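/- Let $F$ be an algebraically closed field and let $k$ be an extension field of $F$ of transcendence degree one over $F$ (not necessarily finitely generated). Let $\lambda \mapsto \bar\lambda$ be an involution of $k$, i.e. a field automorphism of $k$ with $\bar{\bar\lambda} = \lambda$ for all $\lambda \in k$ (the identity is allowed), which is the identity on $F$; assume that the involution is not the identity or that $\operatorname{char} k \neq 2$. Let $V$ be a finite-dimensional vector space over $k$ with $\dim_k V \geq 3$, and let $(\cdot,\cdot) : V \times V \to k$ be a hermitian form, i.e. a map that is linear in the first variable and satisfies $\overline{(v,w)} = (w,v)$ for all $v, w \in V$ (no nondegeneracy is assumed). Then there is a non-zero vector $v \in V$ that is isotropic, i.e. satisfies $(v,v) = 0$. -/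

import Mathlib

/-- A hermitian form on a `k`-vector space `V` with respect to an involution `σ` of `k`:
a map `V × V → k` that is linear in the first variable and satisfies `σ (v, w) = (w, v)`.
No nondegeneracy is required. -/
structure IsHermitianForm {k V : Type*} [Field k] [AddCommGroup V] [Module k V]
    (σ : k ≃+* k) (B : V → V → k) : Prop where
  linear_left : ∀ w : V, IsLinearMap k (fun v : V => B v w)
  conj_symm : ∀ v w : V, σ (B v w) = B w v

/-- A vector `v` is isotropic for `B` if `(v, v) = 0`. -/
def IsIsotropicVector {k V : Type*} [Field k] (B : V → V → k) (v : V) : Prop :=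
  B v v = 0

/-!
Two ideas prove the theorem: Tsen's theorem, in the case of ternary quadratic forms, and a descent
from hermitian forms to quadratic ones.

Let `k₀` be the fixed field of the involution. Each element of `k` is a root of a monic quadratic
polynomial over `k₀`, so `k₀` still has transcendence degree one over `F`
(`AlgEquiv.trdeg_fixedIntermediateField`). If `u₀, u₁, u₂` are linearly independent vectors, then
for `xᵢ ∈ k₀` the value of the hermitian form at `∑ xᵢ uᵢ` is
`∑ᵢ xᵢ² (uᵢ, uᵢ) + ∑_{i < j} xᵢ xⱼ ((uᵢ, uⱼ) + (uⱼ, uᵢ))`, a ternary quadratic form with coefficients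
in `k₀`. It remains to find a non-trivial zero of such a form. The identity involution and
characteristic two need no separate treatment.

A field `K` of transcendence degree one over `F` is algebraic over `F[X]`, with `X` acting as a
transcendental element. After scaling, the coefficients of a form over `K` generate a domain `A`
that is finite over the principal ideal domain `F[X]`, hence free of some rank `d > 0`. Looking for
a zero `x ∈ A³` whose coordinates are polynomials of degree less than `s` gives `3 d s` unknowns in
`F`. The value of the form has coordinates of degree less than `2 s + N`, where `N` depends only on
the form and the structure constants of `A`, so there are `d (2 s + N)` quadratic equations
(`exists_mul_mul_mem_coordDegreeLT`). For `s = N + 1` there are fewer equations than unknowns.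

Finally, fewer than `n` polynomials in `n` variables over `F` that vanish at the origin have another
common zero: otherwise, by the Nullstellensatz, the maximal ideal of the origin would be minimal
over the ideal they generate, and its height `n` would contradict Krull's height theorem.
-/

/-! ### Common zeros of few polynomials -/

open Polynomial in
/-- Every maximal ideal of a polynomial ring in `n` variables over a field has height `n`. -/
theorem MvPolynomial.height_eq_of_isMaximal {F : Type*} [Field F] (n : ℕ)
    (M : Ideal (MvPolynomial (Fin n) F)) [M.IsMaximal] : M.height = n := by
  induction n with
  | zero =>
    have hdim : ringKrullDim (MvPolynomial (Fin 0) F) = 0 := by simp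
    have h := Ideal.height_le_ringKrullDim_of_ne_top (I := M) Ideal.IsPrime.ne_top'
    rw [hdim] at h
    have h' : M.height ≤ 0 := by exact_mod_cast h
    simpa using h'
  | succ n ih =>
    let e := (MvPolynomial.finSuccEquiv F n).toRingEquiv
    let P : Ideal (MvPolynomial (Fin n) F)[X] := M.comap e.symm
    have hP : P.IsMaximal := Ideal.comap_isMaximal_of_equiv e.symm
    have hp : (P.under (MvPolynomial (Fin n) F)).IsMaximal :=
      Polynomial.isMaximal_comap_C_of_isJacobsonRing P
    have : P.LiesOver (P.under (MvPolynomial (Fin n) F)) := ⟨rfl⟩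
    have h1 := Polynomial.height_eq_height_add_one (P.under (MvPolynomial (Fin n) F)) P
    have h2 : P.height = M.height := RingEquiv.height_comap e.symm M
    rw [← h2, h1, ih]
    simp

/-- Over an algebraically closed field, fewer than `n` polynomials in `n` variables that vanish at
the origin have another common zero. -/
theorem MvPolynomial.exists_ne_zero_forall_eval_eq_zero {F : Type*} [Field F] [IsAlgClosed F]
    {ι : Type*} [Fintype ι] {n : ℕ} (hn : Fintype.card ι < n) (p : ι → MvPolynomial (Fin n) F)
    (hp : ∀ i, eval 0 (p i) = 0) : ∃ x : Fin n → F, x ≠ 0 ∧ ∀ i, eval x (p i) = 0 := by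
  by_contra! hcon
  let I : Ideal (MvPolynomial (Fin n) F) := Ideal.span (Set.range p)
  have hzero : zeroLocus F I = {0} := by
    ext x
    simp only [I, zeroLocus_span, Set.mem_ofPred_eq, Set.forall_mem_range, Set.mem_singleton_iff]
    refine ⟨fun h => ?_, fun h => h ▸ hp⟩
    by_contra hx
    obtain ⟨i, hi⟩ := hcon x hx
    exact hi (h i)
  have hrad : I.radical = vanishingIdeal F {(0 : Fin n → F)} := by
    rw [← hzero, vanishingIdeal_zeroLocus_eq_radical]
  have hmin : vanishingIdeal F {(0 : Fin n → F)} ∈ I.minimalPrimes := by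
    rw [← Ideal.radical_minimalPrimes, hrad, Ideal.minimalPrimes_eq_subsingleton_self]
    rfl
  have hle := Ideal.height_le_card_of_mem_minimalPrimes_span (Set.finite_range p) hmin
  rw [height_eq_of_isMaximal] at hle
  have hcard : (Set.range p).ncard ≤ Fintype.card ι := by
    rw [← Nat.card_coe_set_eq, ← Nat.card_eq_fintype_card]
    exact Finite.card_range_le p
  have : n ≤ (Set.range p).ncard := by exact_mod_cast hle
  omega

/-- A bilinear map over an algebraically closed field whose diagonal values lie in a subspace of
dimension less than that of the source has an isotropic vector. -/
theorem LinearMap.exists_ne_zero_apply_self_eq_zero {F V M : Type*} [Field F] [IsAlgClosed F]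
    [AddCommGroup V] [Module F V] [FiniteDimensional F V] [AddCommGroup M] [Module F M]
    (β : V →ₗ[F] V →ₗ[F] M) (U : Submodule F M) [FiniteDimensional F U]
    (hU : ∀ x, β x x ∈ U) (hlt : Module.finrank F U < Module.finrank F V) :
    ∃ x : V, x ≠ 0 ∧ β x x = 0 := by
  obtain ⟨π, hπ⟩ := U.subtype.exists_leftInverse_of_injective U.ker_subtype
  let b := Module.finBasis F V
  let u := Module.finBasis F U
  -- The coordinates of `β x x`, as polynomials in the coordinates of `x`.
  let p : Fin (Module.finrank F U) → MvPolynomial (Fin (Module.finrank F V)) F := fun m =>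
    ∑ i, ∑ j, MvPolynomial.C (u.repr (π (β (b i) (b j))) m) *
      (MvPolynomial.X i * MvPolynomial.X j)
  have hp : ∀ m (x : Fin (Module.finrank F V) → F), MvPolynomial.eval x (p m) =
      u.repr (π (β (∑ i, x i • b i) (∑ i, x i • b i))) m := by
    intro m x
    simp only [p, map_sum, map_mul, MvPolynomial.eval_C, MvPolynomial.eval_X, map_smul,
      LinearMap.sum_apply, LinearMap.smul_apply, Finsupp.coe_finsetSum, Finset.sum_apply,
      Finsupp.smul_apply, smul_eq_mul]
    rw [Finset.sum_comm]
    refine Finset.sum_congr rfl fun i _ => ?_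
    simp only [Finset.mul_sum]
    exact Finset.sum_congr rfl fun j _ => by ring
  obtain ⟨x, hx0, hx⟩ := MvPolynomial.exists_ne_zero_forall_eval_eq_zero
    (by simpa using hlt) p (fun m => by rw [hp]; simp)
  refine ⟨∑ i, x i • b i, fun h => hx0 ?_, ?_⟩
  · funext i
    exact Fintype.linearIndependent_iff.1 b.linearIndependent x h i
  · have h0 : π (β (∑ i, x i • b i) (∑ i, x i • b i)) = 0 := by
      apply u.repr.injective
      ext m
      rw [← hp, hx m]
      simp
    have h1 := LinearMap.congr_fun hπ ⟨_, hU (∑ i, x i • b i)⟩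
    simp only [LinearMap.comp_apply, Submodule.subtype_apply, LinearMap.id_apply, h0] at h1
    exact (congrArg Subtype.val h1).symm

/-! ### Tsen's theorem for ternary quadratic forms -/

section CoordDegreeLT

open Polynomial

variable {F A ι : Type*} [Field F] [CommRing A] [Algebra F A] [Algebra F[X] A]
  [IsScalarTower F F[X] A] [Fintype ι]

/-- The elements of a finite free `F[X]`-algebra all of whose coordinates with respect to the
basis `b` have degree less than `n`. -/
noncomputable def coordDegreeLT (b : Module.Basis ι F[X] A) (n : ℕ) : Submodule F A :=
  (Submodule.pi Set.univ fun _ => degreeLT F n).comap (b.equivFun.restrictScalars F).toLinearMap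

theorem mem_coordDegreeLT {b : Module.Basis ι F[X] A} {n : ℕ} {a : A} :
    a ∈ coordDegreeLT b n ↔ ∀ k, b.repr a k ∈ degreeLT F n := by
  simp [coordDegreeLT, Submodule.mem_pi]

/-- `coordDegreeLT b n` is isomorphic to the space of `ι`-tuples of polynomials of degree less
than `n`. -/
noncomputable def coordDegreeLTEquiv (b : Module.Basis ι F[X] A) (n : ℕ) :
    coordDegreeLT b n ≃ₗ[F] (ι → Fin n → F) :=
  LinearEquiv.trans
    (LinearEquiv.ofBijective
      (LinearMap.pi fun k =>
        (((LinearMap.proj k).comp (b.equivFun.restrictScalars F).toLinearMap).comp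
          (coordDegreeLT b n).subtype).codRestrict (degreeLT F n)
          (fun a => by simpa using mem_coordDegreeLT.1 a.2 k))
      ⟨fun x y h => by
        apply Subtype.ext
        apply b.equivFun.injective
        funext k
        exact congrArg Subtype.val (congrFun h k),
      fun y => ⟨⟨b.equivFun.symm fun k => (y k : F[X]), mem_coordDegreeLT.2 fun k => by
        simpa only [← b.equivFun_apply, LinearEquiv.apply_symm_apply] using (y k).2⟩, by
        funext k
        apply Subtype.ext
        exact congrFun (b.equivFun.apply_symm_apply fun k => (y k : F[X])) k⟩⟩)
    (LinearEquiv.piCongrRight fun _ => degreeLTEquiv F n)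

instance (b : Module.Basis ι F[X] A) (n : ℕ) : FiniteDimensional F (coordDegreeLT b n) :=
  (coordDegreeLTEquiv b n).symm.finiteDimensional

theorem finrank_coordDegreeLT (b : Module.Basis ι F[X] A) (n : ℕ) :
    Module.finrank F (coordDegreeLT b n) = Fintype.card ι * n := by
  rw [(coordDegreeLTEquiv b n).finrank_eq, Module.finrank_pi_fintype]
  simp

theorem exists_mem_degreeLT_of_finite {κ : Type*} [Finite κ] (p : κ → F[X]) :
    ∃ N, ∀ i, p i ∈ degreeLT F N := by
  cases nonempty_fintype κ
  refine ⟨Finset.univ.sup (fun i => (p i).natDegree) + 1, fun i => mem_degreeLT.2 ?_⟩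
  refine lt_of_le_of_lt degree_le_natDegree ?_
  exact_mod_cast Nat.lt_succ_of_le
    (Finset.le_sup (f := fun i => (p i).natDegree) (Finset.mem_univ i))

theorem mul_mem_degreeLT {p q : F[X]} {m n : ℕ} (hp : p ∈ degreeLT F m) (hq : q ∈ degreeLT F n) :
    p * q ∈ degreeLT F (m + n) := by
  by_cases hp0 : p = 0
  · simp [hp0]
  by_cases hq0 : q = 0
  · simp [hq0]
  have hpq : p * q ≠ 0 := mul_ne_zero hp0 hq0
  rw [mem_degreeLT, ← natDegree_lt_iff_degree_lt ‹_›] at *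
  rw [natDegree_mul hp0 hq0]
  omega

/-- Products raise the degree of the coordinates by a bounded amount: the structure constants of
the algebra have bounded degree. -/
theorem exists_mul_mul_mem_coordDegreeLT {κ : Type*} [Finite κ] (b : Module.Basis ι F[X] A)
    (c : κ → A) : ∃ N, ∀ s i, ∀ x ∈ coordDegreeLT b s, ∀ y ∈ coordDegreeLT b s,
      c i * (x * y) ∈ coordDegreeLT b (s + s + N) := by
  obtain ⟨N, hN⟩ := exists_mem_degreeLT_of_finite
    fun t : κ × ι × ι × ι => b.repr (c t.1 * (b t.2.1 * b t.2.2.1)) t.2.2.2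
  refine ⟨N, fun s i x hx y hy => mem_coordDegreeLT.2 fun m => ?_⟩
  rw [mem_coordDegreeLT] at hx hy
  have hxy : c i * (x * y) = ∑ k, ∑ l, (b.repr x k * b.repr y l) • (c i * (b k * b l)) := by
    conv_lhs => rw [← b.sum_repr x, ← b.sum_repr y]
    rw [Finset.sum_mul_sum, Finset.mul_sum]
    refine Finset.sum_congr rfl fun k _ => ?_
    rw [Finset.mul_sum]
    exact Finset.sum_congr rfl fun l _ => by rw [smul_mul_smul_comm, mul_smul_comm]
  rw [hxy]
  simp only [map_sum, map_smul, Finsupp.coe_finsetSum, Finset.sum_apply, Finsupp.smul_apply,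
    smul_eq_mul]
  exact Submodule.sum_mem _ fun k _ => Submodule.sum_mem _ fun l _ =>
    mul_mem_degreeLT (mul_mem_degreeLT (hx k) (hy l)) (hN (i, k, l, m))

/-- Tsen's theorem for ternary quadratic forms over a finite free `F[X]`-algebra. -/
theorem exists_ternary_zero_of_basis [IsAlgClosed F] [Nonempty ι] (b : Module.Basis ι F[X] A)
    (c : Fin 3 → Fin 3 → A) :
    ∃ x : Fin 3 → A, x ≠ 0 ∧ ∑ i, ∑ j, c i j * (x i * x j) = 0 := by
  obtain ⟨N, hN⟩ := exists_mul_mul_mem_coordDegreeLT b fun t : Fin 3 × Fin 3 => c t.1 t.2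
  let β : (Fin 3 → coordDegreeLT b (N + 1)) →ₗ[F] (Fin 3 → coordDegreeLT b (N + 1)) →ₗ[F] A :=
    LinearMap.mk₂ F (fun x y => ∑ i, ∑ j, c i j * ((x i : A) * (y j : A)))
      (fun x x' y => by simp [add_mul, mul_add, Finset.sum_add_distrib])
      (fun a x y => by simp [Finset.smul_sum])
      (fun x y y' => by simp [mul_add, Finset.sum_add_distrib])
      (fun a x y => by simp [Finset.smul_sum])
  obtain ⟨x, hx0, hx⟩ := LinearMap.exists_ne_zero_apply_self_eq_zero β
    (coordDegreeLT b (N + 1 + (N + 1) + N))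
    (fun x => by
      simp only [β, LinearMap.mk₂_apply]
      exact Submodule.sum_mem _ fun i _ => Submodule.sum_mem _ fun j _ =>
        hN (N + 1) (i, j) _ (x i).2 _ (x j).2)
    (by
      -- `3 N + 2 < 3 (N + 1)`: three coordinates against the degree growth `2 s + N`.
      have hd : 0 < Fintype.card ι := Fintype.card_pos
      rw [Module.finrank_pi_fintype]
      simp only [finrank_coordDegreeLT, Finset.sum_const, Finset.card_univ, Fintype.card_fin,
        smul_eq_mul]
      nlinarith)
  refine ⟨fun i => x i, fun h => hx0 ?_, hx⟩
  funext i
  exact Subtype.ext (congrFun h i)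

end CoordDegreeLT

open Polynomial in
/-- Tsen's theorem for ternary quadratic forms: they are isotropic over a field of transcendence
degree one over an algebraically closed field. -/
theorem exists_ternary_zero_of_trdeg_eq_one {F K : Type*} [Field F] [IsAlgClosed F] [Field K]
    [Algebra F K] (htr : Algebra.trdeg F K = 1) (c : Fin 3 → Fin 3 → K) :
    ∃ x : Fin 3 → K, x ≠ 0 ∧ ∑ i, ∑ j, c i j * (x i * x j) = 0 := by
  obtain ⟨s, hs⟩ := exists_isTranscendenceBasis F K
  have hcard : Cardinal.mk s = 1 := by rw [hs.cardinalMk_eq_trdeg, htr]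
  obtain ⟨hsub, ⟨t⟩⟩ := Cardinal.eq_one_iff_unique.1 hcard
  let : Algebra F[X] K := (aeval (R := F) (t : K)).toAlgebra
  have : IsScalarTower F F[X] K := IsScalarTower.of_algebraMap_eq fun a =>
    (aeval_C (t : K) a).symm
  have htrans : Transcendental F (t : K) := hs.1.transcendental t
  have hinj : Function.Injective (algebraMap F[X] K) :=
    transcendental_iff_injective.1 htrans
  have : FaithfulSMul F[X] K := (faithfulSMul_iff_algebraMap_injective _ _).2 hinj
  -- `1 + trdeg F[X] K = 1`, and cancelling is allowed because `1` is a finite cardinal.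
  have halg : Algebra.IsAlgebraic F[X] K := by
    have h := lift_trdeg_add_eq F F[X] K
    rw [Polynomial.trdeg_of_isDomain, htr, Cardinal.lift_one, Cardinal.lift_one] at h
    have h0 : Cardinal.lift (Algebra.trdeg F[X] K) = 0 :=
      Cardinal.eq_of_add_eq_add_left (h.trans (add_zero 1).symm) Cardinal.one_lt_aleph0
    exact trdeg_eq_zero_iff.1 (Cardinal.lift_eq_zero.1 h0)
  classical
  obtain ⟨y, hy0, hy⟩ := Algebra.IsAlgebraic.exists_integral_multiples F[X]
    (Finset.univ.image fun t : Fin 3 × Fin 3 => c t.1 t.2)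
  have hint : ∀ i j, IsIntegral F[X] (y • c i j) := fun i j =>
    hy _ (Finset.mem_image.2 ⟨(i, j), Finset.mem_univ _, rfl⟩)
  -- The coefficients of the form, scaled by `y`, generate a finite free `F[X]`-algebra.
  let S : Set K := Set.range fun t : Fin 3 × Fin 3 => y • c t.1 t.2
  let A : Subalgebra F[X] K := Algebra.adjoin F[X] S
  have hfin : Module.Finite F[X] A := by
    refine Module.Finite.iff_fg.2 (fg_adjoin_of_finite (Set.finite_range _) ?_)
    rintro _ ⟨t, rfl⟩
    exact hint t.1 t.2
  obtain ⟨n, b⟩ := Module.basisOfFiniteTypeTorsionFree' (R := F[X]) (M := A)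
  have : Nonempty (Fin n) := b.index_nonempty
  obtain ⟨x, hx0, hx⟩ := exists_ternary_zero_of_basis (F := F) b fun i j =>
    (⟨y • c i j, Algebra.subset_adjoin ⟨(i, j), rfl⟩⟩ : A)
  refine ⟨fun i => x i, fun h => hx0 (funext fun i => Subtype.ext (congrFun h i)), ?_⟩
  have h := congrArg Subtype.val hx
  have h' : y • ∑ i, ∑ j, c i j * ((x i : K) * (x j : K)) = 0 := by
    simpa [Finset.smul_sum] using h
  rw [Algebra.smul_def] at h'
  exact (mul_eq_zero.1 h').resolve_left fun h0 => hy0 (hinj (by rw [h0, map_zero]))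

/-! ### Descent to the fixed field of the involution -/

section FixedField

variable {F k : Type*} [Field F] [Field k] [Algebra F k]

/-- The fixed field of an `F`-automorphism of `k`. -/
def AlgEquiv.fixedIntermediateField (τ : k ≃ₐ[F] k) : IntermediateField F k :=
  (AlgHom.equalizer τ.toAlgHom (AlgHom.id F k)).toIntermediateField fun x hx => by
    simp only [AlgHom.mem_equalizer, AlgHom.coe_id, id_eq, map_inv₀] at hx ⊢
    rw [hx]

theorem AlgEquiv.mem_fixedIntermediateField {τ : k ≃ₐ[F] k} {x : k} :
    x ∈ τ.fixedIntermediateField ↔ τ x = x := Iff.rfl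

open Polynomial in
/-- Each `x` is a root of `T ^ 2 - (x + τ x) T + x * τ x`. -/
theorem AlgEquiv.isAlgebraic_fixedIntermediateField {τ : k ≃ₐ[F] k} (hτ : ∀ x, τ (τ x) = x) :
    Algebra.IsAlgebraic τ.fixedIntermediateField k := by
  refine ⟨fun x => IsIntegral.isAlgebraic ?_⟩
  let a : τ.fixedIntermediateField := ⟨x + τ x, by
    rw [AlgEquiv.mem_fixedIntermediateField, map_add, hτ, add_comm]⟩
  let d : τ.fixedIntermediateField := ⟨x * τ x, by
    rw [AlgEquiv.mem_fixedIntermediateField, map_mul, hτ, mul_comm]⟩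
  refine ⟨X ^ 2 - C a * X + C d, by monicity!, ?_⟩
  have ha : algebraMap τ.fixedIntermediateField k a = x + τ x := rfl
  have hd : algebraMap τ.fixedIntermediateField k d = x * τ x := rfl
  simp only [eval₂_add, eval₂_sub, eval₂_mul, eval₂_pow, eval₂_X, eval₂_C, ha, hd]
  ring

theorem AlgEquiv.trdeg_fixedIntermediateField {τ : k ≃ₐ[F] k} (hτ : ∀ x, τ (τ x) = x) :
    Algebra.trdeg F τ.fixedIntermediateField = Algebra.trdeg F k := by
  have := AlgEquiv.isAlgebraic_fixedIntermediateField hτ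
  rw [← trdeg_add_eq F τ.fixedIntermediateField (A := k),
    trdeg_eq_zero (R := τ.fixedIntermediateField), add_zero]

end FixedField

/-- On combinations of `u 0, u 1, u 2` with coefficients fixed by `σ`, a hermitian form is given by
a ternary quadratic form. -/
theorem IsHermitianForm.apply_sum_self {k V : Type*} [Field k] [AddCommGroup V] [Module k V]
    {σ : k ≃+* k} {B : V → V → k} (hB : IsHermitianForm σ B) (u : Fin 3 → V) {x : Fin 3 → k}
    (hx : ∀ i, σ (x i) = x i) :
    B (∑ i, x i • u i) (∑ i, x i • u i) = ∑ i, ∑ j, B (u i) (u j) * (x i * x j) := by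
  have hleft : ∀ w, B (∑ i, x i • u i) w = ∑ i, x i * B (u i) w := fun w => by
    let L : V →ₗ[k] k := (hB.linear_left w).mk'
    change L _ = ∑ i, x i * L (u i)
    simp
  have hright : ∀ v, B v (∑ j, x j • u j) = ∑ j, x j * B v (u j) := fun v => by
    rw [← hB.conj_symm, hleft, map_sum]
    simp only [map_mul, hx, hB.conj_symm]
  rw [hleft]
  simp only [hright, Finset.mul_sum]
  exact Finset.sum_congr rfl fun i _ => Finset.sum_congr rfl fun j _ => by ring

theorem mainTheorem2 {F k V : Type*} [Field F] [IsAlgClosed F] [Field k] [Algebra F k]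
    (htr : Algebra.trdeg F k = 1)
    (σ : k ≃+* k) (hσ : ∀ x : k, σ (σ x) = x)
    (hσF : ∀ a : F, σ (algebraMap F k a) = algebraMap F k a)
    (hchar : σ ≠ RingEquiv.refl k ∨ ringChar k ≠ 2)
    [AddCommGroup V] [Module k V] [FiniteDimensional k V]
    (B : V → V → k) (hB : IsHermitianForm σ B)
    (hV : 3 ≤ Module.finrank k V) :
    ∃ v : V, v ≠ 0 ∧ IsIsotropicVector B v := by
  let τ : k ≃ₐ[F] k := AlgEquiv.ofRingEquiv hσF
  obtain ⟨u, hu⟩ := exists_linearIndependent_of_le_finrank hV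
  have hσB : ∀ v w, σ (B v w) = B w v := hB.conj_symm
  -- The off-diagonal coefficients `B (u i) (u j)` need not be fixed by `σ`; the diagonal ones
  -- and the traces `B (u i) (u j) + B (u j) (u i)` are, which gives an upper triangular matrix.
  let c : Fin 3 → Fin 3 → τ.fixedIntermediateField := fun i j =>
    if i = j then ⟨B (u i) (u i), hσB _ _⟩
    else if i < j then ⟨B (u i) (u j) + B (u j) (u i), by
      change σ _ = B (u i) (u j) + B (u j) (u i)
      rw [map_add, hσB, hσB, add_comm]⟩
    else 0
  obtain ⟨x, hx0, hx⟩ := exists_ternary_zero_of_trdeg_eq_one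
    ((AlgEquiv.trdeg_fixedIntermediateField (τ := τ) hσ).trans htr) c
  refine ⟨∑ i, (x i : k) • u i, fun h => hx0 ?_, ?_⟩
  · funext i
    exact Subtype.ext (Fintype.linearIndependent_iff.1 hu (fun i => (x i : k)) h i)
  · rw [IsIsotropicVector, hB.apply_sum_self u fun i => (x i).2]
    have h := congrArg Subtype.val hx
    simp [Fin.sum_univ_three, c] at h ⊢
    linear_combination h
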